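/- Let $n\in\mathbb N$, let $\mathcal S_n$ be the space of real symmetric $n\times n$ matrices with the Frobenius inner product $\langle A,B\rangle=\operatorname{tr}(A^\top B)$, and let $\mathbb R^n$ carry its Euclidean inner product. For a finite-dimensional real Hilbert space $\mathcal H$ and $h\colon\mathcal H\to\,]-\infty,+\infty]$ put $\operatorname{dom}h=\{x\mid h(x)<+\infty\}$ and $\partial h(x)=\{t\in\mathcal H\mid h(z)\ge h(x)+\langle t,z-x\rangle\ \text{for all}\ z\in\mathcal H\}$; $\Gamma_0(\mathcal H)$ is the class of lower-semicontinuous convex functions $\mathcal H\to\,]-\infty,+\infty]$ with nonempty domain; $h$ is supercoercive if $h(x)/\|x\|\to+\infty$ as $\|x\|\to+\infty$. A proper convex function $h$ is Legendre if (a) $h$ is differentiable on $\operatorname{int}(\operatorname{dom}h)\neq\varnothing$ and $\|\nabla h(x_k)\|\to+\infty$ for every sequence $(x_k)$ in $\operatorname{int}(\operatorname{dom}h)$ converging to a boundary point of $\operatorname{dom}h$, and (b) $h$ is strictly convex on every convex subset of $\{x\mid\partial h(x)\neq\varnothing\}$. For such $h$, $D^h(x,y)=h(x)-h(y)-\langle\nabla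 h(y),x-y\rangle$ if $y\in\operatorname{int}(\operatorname{dom}h)$, and $D^h(x,y)=+\infty$ otherwise. If $h\in\Gamma_0(\mathcal H)$ is Legendre, $\ell\in\Gamma_0(\mathcal H)$, $\operatorname{int}(\operatorname{dom}h)\cap\operatorname{dom}\ell\neq\varnothing$, and either $\ell$ is bounded from below or $h+\ell$ is supercoercive, the $D^h$-proximity operator of $\ell$ is the map $\operatorname{prox}^h_\ell\colon\operatorname{int}(\operatorname{dom}h)\to\operatorname{int}(\operatorname{dom}h)\cap\operatorname{dom}\ell$ that sends $y$ to the unique minimizer over $x\in\mathcal H$ of $\ell(x)+D^h(x,y)$. Let $\varphi,\psi\in\Gamma_0(\mathbb R^n)$, where $\varphi$ is Legendre, $\operatorname{int}(\operatorname{dom}\varphi)\cap\operatorname{dom}\psi\neq\varnothing$, and either $\psi$ is bounded from below or $\varphi+\psi$ is supercoercive. Let $f,g_0\colon\mathcal S_n\to\,]-\infty,+\infty]$ be the spectral functions induced by $\varphi$ and $\psi$: for every $C\in\mathcal S_n$, every vector $d\in\mathbb R^n$ of eigenvalues of $C$ (with multiplicity) and every $n\times n$ permutation matrix $\Sigma$,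 $f(C)=\varphi(\Sigma d)$ and $g_0(C)=\psi(\Sigma d)$. Let $Y=U_Y\operatorname{Diag}(y)U_Y^\top$ with $U_Y\in\mathbb R^{n\times n}$ orthogonal and $y\in\operatorname{int}(\operatorname{dom}\varphi)$. Then the $D^\varphi$-proximity operator of $\psi$ is defined at $y$, and the $D^f$-proximity operator of $g_0$ is defined at $Y$; that is, $f$ and $g_0$ satisfy the above conditions on $h$ and $\ell$, $Y\in\operatorname{int}(\operatorname{dom}f)$, and $g_0+D^f(\cdot,Y)$ has a unique minimizer over $\mathcal S_n$, which lies in $\operatorname{int}(\operatorname{dom}f)\cap\operatorname{dom}g_0$ (and likewise for $\varphi,\psi,y$). Moreover $$\operatorname{prox}^f_{g_0}(Y)=U_Y\operatorname{Diag}\big(\operatorname{prox}^\varphi_\psi(y)\big)U_Y^\top .$$ -/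

import Mathlib

open Set Filter Topology Matrix

noncomputable section

/-! ### Extended-real-valued functions on a real Hilbert space -/

section ConvexAnalysis

variable {H : Type*} [NormedAddCommGroup H] [InnerProductSpace ℝ H]

/-- The (effective) domain of an extended-real-valued function. -/
def effDom (h : H → EReal) : Set H := {x | h x < ⊤}

/-- The real-valued function that agrees with `h` wherever `h` is finite. -/
def finitePart (h : H → EReal) : H → ℝ := fun x => (h x).toReal

/-- The class `Γ₀(H)`: lower-semicontinuous convex functions `H → ]-∞, +∞]` with nonempty domain.
As `h` never takes the value `-∞`, convexity of `h` is convexity of its domain together with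
convexity of `h` as a real-valued function on its domain. -/
structure IsGammaZero (h : H → EReal) : Prop where
  ne_bot : ∀ x, h x ≠ ⊥
  proper : (effDom h).Nonempty
  lsc : LowerSemicontinuous h
  convex : ConvexOn ℝ (effDom h) (finitePart h)

/-- The Moreau subdifferential. -/
def subdiff (h : H → EReal) (x : H) : Set H :=
  {t | ∀ y, h x + ((inner ℝ t (y - x) : ℝ) : EReal) ≤ h y}

/-- `h` is bounded from below (by a real number). -/
def IsBddBelow (h : H → EReal) : Prop := ∃ m : ℝ, ∀ x, (m : EReal) ≤ h x

/-- `h x / ‖x‖ → +∞` as `‖x‖ → +∞`. -/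
def IsSupercoercive (h : H → EReal) : Prop :=
  Tendsto (fun x => h x / (‖x‖ : EReal)) (Bornology.cobounded H) (𝓝 ⊤)

/-- `h` is strictly convex on every convex subset of the domain of its subdifferential. -/
def IsEssStrictlyConvex (h : H → EReal) : Prop :=
  ∀ K : Set H, K ⊆ {x | (subdiff h x).Nonempty} → Convex ℝ K → StrictConvexOn ℝ K (finitePart h)

/-- `p` is the unique minimizer of `F` over the whole space. -/
def IsUniqueMinimizer (F : H → EReal) (p : H) : Prop :=
  (∀ x, F p ≤ F x) ∧ ∀ q, (∀ x, F q ≤ F x) → q = p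

variable [CompleteSpace H]

/-- `h` is differentiable on the nonempty interior of its domain, and the norm of its gradient
blows up along every sequence of interior points converging to a boundary point of the domain. -/
structure IsEssSmooth (h : H → EReal) : Prop where
  nonempty : (interior (effDom h)).Nonempty
  differentiable : ∀ x ∈ interior (effDom h), DifferentiableAt ℝ (finitePart h) x
  blowup : ∀ (u : ℕ → H) (x : H), (∀ k, u k ∈ interior (effDom h)) → x ∈ frontier (effDom h) →
    Tendsto u atTop (𝓝 x) → Tendsto (fun k => ‖gradient (finitePart h) (u k)‖) atTop atTop

/-- Legendre functions. -/
structure IsLegendre (h : H → EReal) : Prop where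
  smooth : IsEssSmooth h
  strict : IsEssStrictlyConvex h

open Classical in
/-- The Bregman divergence `D^h(x, y)`. -/
def bregmanDiv (h : H → EReal) (x y : H) : EReal :=
  if y ∈ interior (effDom h) then
    h x - h y - ((inner ℝ (gradient (finitePart h) y) (x - y) : ℝ) : EReal)
  else ⊤

/-- The conditions under which the `D^h`-proximity operator of `l` is introduced. -/
structure BregmanProxAdmissible (h l : H → EReal) : Prop where
  gammaZero_left : IsGammaZero h
  legendre : IsLegendre h
  gammaZero_right : IsGammaZero l
  domains : (interior (effDom h) ∩ effDom l).Nonempty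
  growth : IsBddBelow l ∨ IsSupercoercive (fun x => h x + l x)

/-- `p` is the value at `y` of the `D^h`-proximity operator of `l`: it lies in
`int (dom h) ∩ dom l` and is the unique minimizer over `H` of `x ↦ l x + D^h(x, y)`. -/
def IsBregmanProx (h l : H → EReal) (y p : H) : Prop :=
  p ∈ interior (effDom h) ∩ effDom l ∧ IsUniqueMinimizer (fun x => l x + bregmanDiv h x y) p

/-- The `D^h`-proximity operator of `l` is (legitimately) defined at `y`. -/
structure BregmanProxDefinedAt (h l : H → EReal) (y : H) : Prop where
  admissible : BregmanProxAdmissible h l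
  mem : y ∈ interior (effDom h)
  exists_prox : ∃ p, IsBregmanProx h l y p

open Classical in
/-- The `D^h`-proximity operator of `l`; it takes the irrelevant value `0` wherever the unique
minimizer does not exist. -/
def bregmanProx (h l : H → EReal) (y : H) : H :=
  if hp : ∃ p, IsBregmanProx h l y p then hp.choose else 0

end ConvexAnalysis

/-! ### The Hilbert space of real symmetric matrices with the Frobenius norm -/

/-- The subspace of symmetric matrices. -/
def symSubmodule (n : ℕ) : Submodule ℝ (Matrix (Fin n) (Fin n) ℝ) where
  carrier := {A | A.IsSymm}
  add_mem' := fun ha hb => ha.add hb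
  zero_mem' := Matrix.isSymm_zero
  smul_mem' := fun c _ ha => ha.smul c

/-- The space `S_n` of real symmetric `n × n` matrices. -/
def SymMat (n : ℕ) : Type := symSubmodule n

namespace SymMat

variable {n : ℕ}

instance : AddCommGroup (SymMat n) := inferInstanceAs (AddCommGroup (symSubmodule n))

instance : Module ℝ (SymMat n) := inferInstanceAs (Module ℝ (symSubmodule n))

instance : FiniteDimensional ℝ (SymMat n) :=
  inferInstanceAs (FiniteDimensional ℝ (symSubmodule n))

/-- The underlying matrix. -/
def toMat (A : SymMat n) : Matrix (Fin n) (Fin n) ℝ := Subtype.val A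

/-- The Frobenius inner product `⟨A, B⟩ = tr (Aᵀ B)`. -/
@[reducible] def frobeniusCore (n : ℕ) : InnerProductSpace.Core ℝ (SymMat n) where
  inner A B := (A.toMatᵀ * B.toMat).trace
  conj_inner_symm A B := by
    change (B.toMatᵀ * A.toMat).trace = (A.toMatᵀ * B.toMat).trace
    rw [← Matrix.trace_transpose, Matrix.transpose_mul, Matrix.transpose_transpose]
  re_inner_nonneg A := by
    change 0 ≤ (A.toMatᵀ * A.toMat).trace
    simp only [Matrix.trace, Matrix.diag_apply, Matrix.mul_apply, Matrix.transpose_apply]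
    exact Finset.sum_nonneg fun i _ => Finset.sum_nonneg fun j _ => mul_self_nonneg _
  add_left A B C := by
    change ((A.toMat + B.toMat)ᵀ * C.toMat).trace = _
    rw [Matrix.transpose_add, Matrix.add_mul, Matrix.trace_add]
  smul_left A B c := by
    change ((c • A.toMat)ᵀ * B.toMat).trace = _
    rw [Matrix.transpose_smul, Matrix.smul_mul, Matrix.trace_smul]
    rfl
  definite A h := by
    have h0 : (A.toMatᵀ * A.toMat).trace = 0 := h
    rw [← Matrix.conjTranspose_eq_transpose_of_trivial,
      Matrix.trace_conjTranspose_mul_self_eq_zero_iff] at h0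
    exact Subtype.ext h0

instance : NormedAddCommGroup (SymMat n) := (frobeniusCore n).toNormedAddCommGroup

instance : InnerProductSpace ℝ (SymMat n) := InnerProductSpace.ofCore (frobeniusCore n).toCore

instance : CompleteSpace (SymMat n) := FiniteDimensional.complete ℝ (SymMat n)

end SymMat

/-- `d` is a vector of eigenvalues of `C`: its entries are, in some order, the eigenvalues of `C`
counted with multiplicity. -/
def IsEigenvalueVector {n : ℕ} (C : SymMat n) (d : EuclideanSpace ℝ (Fin n)) : Prop :=
  C.toMat.charpoly.roots = Finset.univ.val.map (fun i => d i)

/-- `f` is the spectral function induced by `φ`: for every symmetric matrix `C`, every vector `d`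
of eigenvalues of `C` and every permutation of the entries of `d`, the value `f C` is the value of
`φ` at the permuted vector. -/
def IsSpectralOf {n : ℕ} (f : SymMat n → EReal) (φ : EuclideanSpace ℝ (Fin n) → EReal) : Prop :=
  ∀ (C : SymMat n) (d : EuclideanSpace ℝ (Fin n)), IsEigenvalueVector C d →
    ∀ σ : Equiv.Perm (Fin n), f C = φ (WithLp.toLp 2 (fun i => d (σ i)))

end

/-! Fix an orthogonal `U`. The maps `diagConj U : d ↦ U Diag(d) Uᵀ` and `diagPart U : C ↦ diag(Uᵀ C
U)` are adjoint, and the second is a left inverse of the first. If `C = V Diag(d) Vᵀ`, then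
`diagPart U C` is the image of `d` under the entrywise square of `Uᵀ V`, a doubly stochastic matrix.
By Birkhoff's theorem it lies in the convex hull of the permutations of `d`
(`diagPart_diagConj_mem_convexHull`). Since `φ` is convex and permutation invariant, `φ (diagPart U
C) ≤ f C` (`diagPart_le`), with equality for `C = diagConj U d`.

This inequality transfers convexity and subgradients from `φ` to `f`; its strict form `diagPart_lt`
gives essential strict convexity. Compactness of the orthogonal group supplies the topology:
closedness, interiors, and continuity of `U Diag(∇φ(x)) Uᵀ`, which is therefore the gradient of `f`
(`hasGradientAt`).

As `∇f(Y)` is diagonal in the basis `U`, the linear term of `D^f(Z, Y)` sees only `diagPart U Z`.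
Replacing `Z` by its diagonal in that basis does not increase the objective, and on such diagonal
matrices the objective is `ψ + D^φ(·, y)`. Hence `diagConj U p` is a minimizer when `p` is
(`isBregmanProx_diagConj`). Existence (`definedAt`) comes from compact sublevel sets. Uniqueness
comes from strict convexity on the interior of the domain, where gradient blow-up forces every
minimizer to lie. -/

/-! ### Gradients of real-valued convex functions. -/

section RealConvex

variable {H : Type*} [NormedAddCommGroup H] [InnerProductSpace ℝ H] [CompleteSpace H]
  {D : Set H} {F : H → ℝ}

/-- The gradient of a convex function is a subgradient. -/
lemma ConvexOn.add_inner_gradient_le (hF : ConvexOn ℝ D F) {x y : H} (hy : y ∈ D) (hx : x ∈ D)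
    (hd : DifferentiableAt ℝ F y) : F y + inner ℝ (gradient F y) (x - y) ≤ F x := by
  have hg := hd.hasGradientAt.hasFDerivAt
  have hline : HasDerivAt (fun t : ℝ => y + t • (x - y)) (x - y) 0 := by
    simpa using ((hasDerivAt_id (0 : ℝ)).smul_const (x - y)).const_add y
  have hg' : HasFDerivAt F (InnerProductSpace.toDual ℝ H (gradient F y))
      ((fun t : ℝ => y + t • (x - y)) 0) := by simpa using hg
  have hc := hg'.comp_hasDerivAt (0 : ℝ) hline
  have ht := hc.tendsto_slope_zero_right
  have hle := le_of_tendsto ht (b := F x - F y) (by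
    filter_upwards [Ioo_mem_nhdsGT (zero_lt_one' ℝ)] with t ht
    have h1 := hF.2 hy hx (sub_nonneg.2 ht.2.le) ht.1.le (by ring)
    have e : (1 - t) • y + t • x = y + t • (x - y) := by module
    rw [e] at h1
    simp only [Function.comp, zero_add, zero_smul, add_zero, smul_eq_mul] at h1 ⊢
    rw [inv_mul_le_iff₀ ht.1]
    linarith)
  simp only [InnerProductSpace.toDual_apply_apply] at hle
  linarith

/-- A subgradient on a neighbourhood of a point of differentiability is the gradient. -/
lemma eq_gradient_of_eventually_le {x g : H} (hd : DifferentiableAt ℝ F x)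
    (hg : ∀ᶠ w in 𝓝 x, F x + inner ℝ g (w - x) ≤ F w) : g = gradient F x := by
  have h1 := hd.hasGradientAt.hasFDerivAt
  have h2 : HasFDerivAt (fun w => F w - InnerProductSpace.toDual ℝ H g w)
      (InnerProductSpace.toDual ℝ H (gradient F x) - InnerProductSpace.toDual ℝ H g) x :=
    h1.sub (ContinuousLinearMap.hasFDerivAt _)
  have hmin : IsLocalMin (fun w => F w - InnerProductSpace.toDual ℝ H g w) x := by
    filter_upwards [hg] with w hw
    simp only [InnerProductSpace.toDual_apply_apply]
    rw [inner_sub_right] at hw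
    linarith
  have h3 := hmin.hasFDerivAt_eq_zero h2
  exact ((InnerProductSpace.toDual ℝ H).injective (sub_eq_zero.1 h3)).symm

/-- A selection of subgradients that is continuous at a point gives the gradient there. -/
lemma hasGradientAt_of_continuousAt_subgradient {x : H} {N : Set H} (hN : N ∈ 𝓝 x) {G : H → H}
    (hG : ∀ u ∈ N, ∀ v ∈ N, F u + inner ℝ (G u) (v - u) ≤ F v) (hc : ContinuousAt G x) :
    HasGradientAt F (G x) x := by
  rw [hasGradientAt_iff_isLittleO, Asymptotics.isLittleO_iff]
  intro c hcpos
  filter_upwards [hN, Metric.continuousAt_iff'.1 hc c hcpos] with u hu hGu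
  have hx := mem_of_mem_nhds hN
  -- The two subgradient inequalities place the remainder `F u - F x - ⟨G x, u - x⟩` between `0` and
  -- `⟨G u - G x, u - x⟩`.
  have h1 := hG x hx u hu
  have h2 := hG u hu x hx
  have h3 : inner ℝ (G u - G x) (u - x) ≤ c * ‖u - x‖ :=
    (real_inner_le_norm _ _).trans (by rw [← dist_eq_norm]; gcongr)
  have h4 : inner ℝ (G u) (x - u) = - inner ℝ (G u) (u - x) := by
    rw [← inner_neg_right, neg_sub]
  rw [inner_sub_left] at h3
  rw [Real.norm_of_nonneg (by linarith)]
  linarith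

/-- A local Lipschitz constant of a convex function bounds its gradient. -/
lemma ConvexOn.eventually_norm_gradient_le [FiniteDimensional ℝ H] (hF : ConvexOn ℝ D F)
    (hd : ∀ x ∈ interior D, DifferentiableAt ℝ F x) {x : H} (hx : x ∈ interior D) :
    ∃ K : ℝ, ∀ᶠ u in 𝓝 x, ‖gradient F u‖ ≤ K := by
  obtain ⟨K, t, ht, hK⟩ := hF.locallyLipschitzOn_interior hx
  rw [isOpen_interior.nhdsWithin_eq hx] at ht
  refine ⟨K, ?_⟩
  filter_upwards [eventually_mem_nhds_iff.2 ht, isOpen_interior.mem_nhds hx] with u hu hu'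
  have := (hd u hu').hasGradientAt.hasFDerivAt.le_of_lipschitzOn hu hK
  rwa [LinearIsometryEquiv.norm_map] at this

/-- The gradient of a differentiable convex function is continuous. -/
lemma ConvexOn.continuousAt_gradient [FiniteDimensional ℝ H] (hF : ConvexOn ℝ D F)
    (hd : ∀ x ∈ interior D, DifferentiableAt ℝ F x) {x : H} (hx : x ∈ interior D) :
    ContinuousAt (gradient F) x := by
  obtain ⟨K, hK⟩ := hF.eventually_norm_gradient_le hd hx
  -- Gradients near `x` are bounded, so they have cluster points; the tangent inequality passes to
  -- the limit and makes each cluster point a subgradient at `x`, hence the gradient.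
  refine tendsto_of_seq_tendsto fun u hu => tendsto_of_subseq_tendsto fun ns hns => ?_
  have hun : Tendsto (fun k => u (ns k)) atTop (𝓝 x) := hu.comp hns
  obtain ⟨g, -, ms, hms, hg⟩ := tendsto_subseq_of_frequently_bounded
    (Metric.isBounded_closedBall (x := (0 : H)) (r := K))
    (x := fun k => gradient F (u (ns k)))
    (Eventually.frequently (by
      filter_upwards [hun.eventually hK] with k hk
      simpa using hk))
  refine ⟨ms, ?_⟩
  have hum : Tendsto (fun k => u (ns (ms k))) atTop (𝓝 x) := hun.comp hms.tendsto_atTop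
  have hgx : g = gradient F x := by
    refine eq_gradient_of_eventually_le (hd x hx) ?_
    filter_upwards [isOpen_interior.mem_nhds hx] with w hw
    have h1 : Tendsto (fun k => F (u (ns (ms k))) +
        inner ℝ (gradient F (u (ns (ms k)))) (w - u (ns (ms k)))) atTop
        (𝓝 (F x + inner ℝ g (w - x))) :=
      ((hd x hx).continuousAt.tendsto.comp hum).add (hg.inner (tendsto_const_nhds.sub hum))
    refine le_of_tendsto h1 ?_
    filter_upwards [hum.eventually (isOpen_interior.mem_nhds hx)] with k hk
    exact hF.add_inner_gradient_le (interior_subset hk) (interior_subset hw) (hd _ hk)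
  rw [← hgx]
  exact hg

/-- A differentiable strictly convex function lies strictly above its tangent. -/
lemma ConvexOn.add_inner_gradient_lt (hF : ConvexOn ℝ D F) (hs : StrictConvexOn ℝ (interior D) F)
    {x y : H} (hy : y ∈ interior D) (hx : x ∈ interior D) (hd : DifferentiableAt ℝ F y)
    (hxy : x ≠ y) : F y + inner ℝ (gradient F y) (x - y) < F x := by
  have h1 := hs.2 hy hx hxy.symm (by norm_num : (0 : ℝ) < 1 / 2) (by norm_num : (0 : ℝ) < 1 / 2)
    (by norm_num)
  have hm := hs.1 hy hx (by norm_num : (0 : ℝ) ≤ 1 / 2) (by norm_num : (0 : ℝ) ≤ 1 / 2)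
    (by norm_num)
  have h2 := hF.add_inner_gradient_le (interior_subset hy) (interior_subset hm) hd
  have e : (1 / 2 : ℝ) • y + (1 / 2 : ℝ) • x - y = (1 / 2 : ℝ) • (x - y) := by module
  rw [e, inner_smul_right] at h2
  simp only [smul_eq_mul] at h1
  linarith

/-- Away from `y` the Bregman divergence from `y` grows at least linearly. -/
lemma ConvexOn.exists_mul_norm_sub_le [FiniteDimensional ℝ H] (hF : ConvexOn ℝ D F)
    (hs : StrictConvexOn ℝ (interior D) F) {y : H} (hy : y ∈ interior D)
    (hd : DifferentiableAt ℝ F y) :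
    ∃ ε > 0, ∃ δ > 0, ∀ x ∈ D, ε ≤ ‖x - y‖ →
      F y + inner ℝ (gradient F y) (x - y) + δ * ‖x - y‖ ≤ F x := by
  obtain ⟨ε, hε, hball⟩ := Metric.nhds_basis_closedBall.mem_iff.1 (isOpen_interior.mem_nhds hy)
  have hsub : Metric.sphere y ε ⊆ interior D := Metric.sphere_subset_closedBall.trans hball
  obtain hemp | hne := (Metric.sphere y ε).eq_empty_or_nonempty
  -- The sphere is empty only in dimension zero; then no point is at distance `ε` or more, and any
  -- `δ` serves.
  · refine ⟨ε, hε, 1, one_pos, fun x _ hx => ?_⟩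
    exfalso
    have hpos : 0 < ‖x - y‖ := hε.trans_le hx
    have : y + (ε / ‖x - y‖) • (x - y) ∈ Metric.sphere y ε := by
      simp [norm_smul, abs_of_pos hε, hpos.ne']
    simp [hemp] at this
  · have hcont : ContinuousOn (fun x => F x - F y - inner ℝ (gradient F y) (x - y))
        (Metric.sphere y ε) :=
      (((hF.continuousOn_interior).mono hsub).sub continuousOn_const).sub (by fun_prop)
    obtain ⟨z, hz, hmin⟩ := (isCompact_sphere y ε).exists_isMinOn hne hcont
    have hzy : z ≠ y := by
      rintro rfl
      simp [hε.ne] at hz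
    have hpos := hF.add_inner_gradient_lt hs hy (hsub hz) hd hzy
    -- `δ` is the least gap above the tangent on the sphere, divided by its radius; convexity along
    -- the segment from `y` propagates it outwards.
    refine ⟨ε, hε, (F z - F y - inner ℝ (gradient F y) (z - y)) / ε,
      div_pos (by linarith) hε, fun x hx hxε => ?_⟩
    have hxpos : 0 < ‖x - y‖ := hε.trans_le hxε
    set s := ε / ‖x - y‖ with hsdef
    have hs0 : 0 < s := div_pos hε hxpos
    have hs1 : s ≤ 1 := (div_le_one hxpos).2 hxε
    have hw : y + s • (x - y) ∈ Metric.sphere y ε := by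
      simp [norm_smul, abs_of_pos hε, hxpos.ne', hsdef]
    have h1 := hmin hw
    have h2 := hF.2 (interior_subset hy) hx (sub_nonneg.2 hs1) hs0.le (by ring)
    have e : (1 - s) • y + s • x = y + s • (x - y) := by module
    rw [e] at h2
    simp only [smul_eq_mul, mem_ofPred_eq, add_sub_cancel_left, inner_smul_right] at h1 h2
    have h3 : F z - F y - inner ℝ (gradient F y) (z - y) ≤
        s * (F x - F y - inner ℝ (gradient F y) (x - y)) := by linarith
    have h4 : (F z - F y - inner ℝ (gradient F y) (z - y)) / ε * ‖x - y‖ ≤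
        F x - F y - inner ℝ (gradient F y) (x - y) := by
      rw [div_mul_eq_mul_div, div_le_iff₀ hε]
      rw [hsdef, div_mul_eq_mul_div, le_div_iff₀ hxpos] at h3
      linarith
    linarith

/-- At a boundary point of its domain, an essentially smooth convex function has slope `-∞` in
every direction that points into the interior. -/
lemma ConvexOn.exists_lt_sub_mul [FiniteDimensional ℝ H] (hF : ConvexOn ℝ D F)
    (hd : ∀ x ∈ interior D, DifferentiableAt ℝ F x)
    (hb : ∀ (u : ℕ → H) (x : H), (∀ k, u k ∈ interior D) → x ∈ frontier D →
      Tendsto u atTop (𝓝 x) → Tendsto (fun k => ‖gradient F (u k)‖) atTop atTop)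
    {p q : H} (hp : p ∈ D) (hp' : p ∉ interior D) (hq : q ∈ interior D) (M : ℝ) :
    ∃ t ∈ Ioc (0 : ℝ) 1, F (p + t • (q - p)) < F p - M * t := by
  -- A slope bounded below along the segment from `p` to `q` would, as `F` is bounded above near
  -- `q`, bound the gradients along the segment, against their blow-up at `p`.
  by_contra! hcon
  obtain ⟨ε, hε, hball⟩ := Metric.nhds_basis_closedBall.mem_iff.1 (isOpen_interior.mem_nhds hq)
  obtain ⟨K, hK⟩ := (isCompact_closedBall q ε).bddAbove_image
    (hF.continuousOn_interior.mono hball)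
  have hK' : ∀ x ∈ Metric.closedBall q ε, F x ≤ K := fun x hx => hK (mem_image_of_mem F hx)
  have hbound : ∀ t ∈ Ioc (0 : ℝ) 1,
      ‖gradient F (p + t • (q - p))‖ ≤ (K - F p + 2 * |M|) / ε := by
    intro t ht
    have hxt : p + t • (q - p) ∈ interior D := hF.1.add_smul_sub_mem_interior hp hq ht
    set x := p + t • (q - p) with hx
    set g := gradient F x with hg
    have hF1 := hcon t ht
    have hslope : -M ≤ inner ℝ g (q - p) := by
      have h1 := hF.add_inner_gradient_le (interior_subset hxt) hp (hd x hxt)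
      have e : p - x = (-t) • (q - p) := by rw [hx]; module
      rw [e, inner_smul_right, ← hg] at h1
      have : -M * t ≤ inner ℝ g (q - p) * t := by linarith
      exact le_of_mul_le_mul_right this ht.1
    have hMt : M * t ≤ |M| := by
      calc M * t ≤ |M| * t := mul_le_mul_of_nonneg_right (le_abs_self M) ht.1.le
        _ ≤ |M| * 1 := by gcongr; exact ht.2
        _ = |M| := mul_one _
    have hMt' : M * (1 - t) ≤ |M| := by
      have h1 := ht.1
      have h2 := ht.2
      calc M * (1 - t) ≤ |M| * (1 - t) :=
          mul_le_mul_of_nonneg_right (le_abs_self M) (sub_nonneg.2 h2)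
        _ ≤ |M| * 1 := by gcongr; linarith
        _ = |M| := mul_one _
    rw [le_div_iff₀ hε]
    by_cases hg0 : g = 0
    · have h5 := hK' q (Metric.mem_closedBall_self hε.le)
      have h6 := hcon 1 ⟨one_pos, le_rfl⟩
      simp only [one_smul, add_sub_cancel, mul_one] at h6
      have := le_abs_self M
      have := abs_nonneg M
      rw [hg0, norm_zero, zero_mul]
      linarith
    have hgn : 0 < ‖g‖ := norm_pos_iff.2 hg0
    -- Moving from `q` by `ε` in the direction of `g` adds `ε * ‖g‖` to the tangent inequality while
    -- `F` stays below `K`.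
    have hz : q + (ε / ‖g‖) • g ∈ Metric.closedBall q ε := by
      simp [norm_smul, abs_of_pos hε, hgn.ne']
    have h2 := hF.add_inner_gradient_le (interior_subset hxt) (interior_subset (hball hz)) (hd x hxt)
    have e : q + (ε / ‖g‖) • g - x = (1 - t) • (q - p) + (ε / ‖g‖) • g := by rw [hx]; module
    rw [e, inner_add_right, inner_smul_right, inner_smul_right, ← hg,
      real_inner_self_eq_norm_sq] at h2
    have e2 : ε / ‖g‖ * ‖g‖ ^ 2 = ‖g‖ * ε := by field_simp
    rw [e2] at h2
    have h3 := hK' _ hz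
    have h4 : -(M * (1 - t)) ≤ (1 - t) * inner ℝ g (q - p) := by
      have := mul_le_mul_of_nonneg_left hslope (sub_nonneg.2 ht.2)
      linarith
    linarith
  have hu0 : ∀ k : ℕ, (1 : ℝ) / (k + 1) ∈ Ioc (0 : ℝ) 1 := fun k =>
    ⟨by positivity, by rw [div_le_one (by positivity)]; linarith [k.cast_nonneg (α := ℝ)]⟩
  have hlim : Tendsto (fun k : ℕ => p + ((1 : ℝ) / (k + 1)) • (q - p)) atTop (𝓝 p) := by
    simpa using tendsto_const_nhds.add
      ((tendsto_one_div_add_atTop_nhds_zero_nat (𝕜 := ℝ)).smul_const (q - p))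
  have ht := hb _ p (fun k => hF.1.add_smul_sub_mem_interior hp hq (hu0 k))
    ⟨subset_closure hp, hp'⟩ hlim
  obtain ⟨k, hk⟩ := (ht.eventually_gt_atTop ((K - F p + 2 * |M|) / ε)).exists
  exact absurd (hbound _ (hu0 k)) (not_le.2 hk)

end RealConvex

/-! ### Existence, uniqueness and location of Bregman proximal points. -/

section GammaZero

lemma eq_top_of_notMem_effDom {H : Type*} {h : H → EReal} {x : H} (hx : x ∉ effDom h) :
    h x = ⊤ := not_lt_top_iff.1 hx

variable {H : Type*} [NormedAddCommGroup H] [InnerProductSpace ℝ H] {h l : H → EReal}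

lemma IsGammaZero.coe_finitePart (hh : IsGammaZero h) {x : H} (hx : x ∈ effDom h) :
    ((finitePart h x : ℝ) : EReal) = h x :=
  EReal.coe_toReal (ne_of_lt hx) (hh.ne_bot x)

lemma IsGammaZero.mem_subdiff_iff (hh : IsGammaZero h) {x t : H} (hx : x ∈ effDom h) :
    t ∈ subdiff h x ↔
      ∀ y ∈ effDom h, finitePart h x + inner ℝ t (y - x) ≤ finitePart h y := by
  constructor
  · intro ht y hy
    have := ht y
    rw [← hh.coe_finitePart hx, ← hh.coe_finitePart hy] at this
    exact_mod_cast this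
  · intro ht y
    by_cases hy : y ∈ effDom h
    · rw [← hh.coe_finitePart hx, ← hh.coe_finitePart hy]
      exact_mod_cast ht y hy
    · rw [eq_top_of_notMem_effDom hy]
      exact le_top

lemma IsGammaZero.mem_effDom_of_subdiff (hh : IsGammaZero h) {x : H}
    (hx : (subdiff h x).Nonempty) : x ∈ effDom h := by
  by_contra hcon
  obtain ⟨t, ht⟩ := hx
  obtain ⟨y, hy⟩ := hh.proper
  have := ht y
  rw [eq_top_of_notMem_effDom hcon, EReal.top_add_coe] at this
  exact absurd hy (not_lt.2 this)

variable [CompleteSpace H]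

lemma IsGammaZero.gradient_mem_subdiff (hh : IsGammaZero h) {x : H} (hx : x ∈ effDom h)
    (hd : DifferentiableAt ℝ (finitePart h) x) : gradient (finitePart h) x ∈ subdiff h x :=
  (hh.mem_subdiff_iff hx).2 fun _ hy => hh.convex.add_inner_gradient_le hx hy hd

/-- An essentially smooth function is subdifferentiable only in the interior of its domain. -/
lemma IsGammaZero.mem_interior_of_subdiff [FiniteDimensional ℝ H] (hh : IsGammaZero h)
    (hs : IsEssSmooth h) {x : H} (hx : (subdiff h x).Nonempty) : x ∈ interior (effDom h) := by
  by_contra hcon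
  have hxd := hh.mem_effDom_of_subdiff hx
  obtain ⟨t, ht⟩ := hx
  obtain ⟨q, hq⟩ := hs.nonempty
  -- The slope is chosen so that `h` falls strictly below the affine minorant given by `t`.
  obtain ⟨s, hs0, hlt⟩ := hh.convex.exists_lt_sub_mul hs.differentiable hs.blowup hxd hcon hq
    (-inner ℝ t (q - x))
  have h1 := (hh.mem_subdiff_iff hxd).1 ht _
    (interior_subset (hh.convex.1.add_smul_sub_mem_interior hxd hq hs0))
  rw [add_sub_cancel_left, inner_smul_right] at h1
  linarith

/-- Gradients are subgradients, so the interior is an admissible convex set in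
`IsEssStrictlyConvex`. -/
lemma IsGammaZero.strictConvexOn_interior (hh : IsGammaZero h) (hL : IsLegendre h) :
    StrictConvexOn ℝ (interior (effDom h)) (finitePart h) :=
  hL.strict _ (fun x hx => ⟨_, hh.gradient_mem_subdiff (interior_subset hx)
    (hL.smooth.differentiable x hx)⟩) hh.convex.1.interior

lemma add_bregmanDiv_eq_coe (hh : IsGammaZero h) (hl : IsGammaZero l) {x y : H}
    (hy : y ∈ interior (effDom h)) (hx : x ∈ effDom h) (hx' : x ∈ effDom l) :
    l x + bregmanDiv h x y = ((finitePart l x + (finitePart h x - finitePart h y -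
      inner ℝ (gradient (finitePart h) y) (x - y)) : ℝ) : EReal) := by
  rw [bregmanDiv, if_pos hy, ← hh.coe_finitePart hx, ← hl.coe_finitePart hx',
    ← hh.coe_finitePart (interior_subset hy)]
  norm_cast

lemma bregmanDiv_eq_top (hh : IsGammaZero h) {x y : H} (hy : y ∈ interior (effDom h))
    (hx : x ∉ effDom h) : bregmanDiv h x y = ⊤ := by
  rw [bregmanDiv, if_pos hy, eq_top_of_notMem_effDom hx,
    ← hh.coe_finitePart (interior_subset hy), EReal.top_sub_coe, EReal.top_sub_coe]

lemma bregmanDiv_ne_bot (hh : IsGammaZero h) {x y : H} (hy : y ∈ interior (effDom h)) :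
    bregmanDiv h x y ≠ ⊥ := by
  by_cases hx : x ∈ effDom h
  · rw [bregmanDiv, if_pos hy, ← hh.coe_finitePart hx, ← hh.coe_finitePart (interior_subset hy)]
    norm_cast
    exact EReal.coe_ne_bot _
  · rw [bregmanDiv_eq_top hh hy hx]
    exact bot_lt_top.ne'

lemma mem_effDom_of_add_bregmanDiv_lt_top (hh : IsGammaZero h) (hl : IsGammaZero l) {x y : H}
    (hy : y ∈ interior (effDom h)) (hx : l x + bregmanDiv h x y < ⊤) :
    x ∈ effDom h ∧ x ∈ effDom l := by
  constructor
  · by_contra hcon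
    rw [bregmanDiv_eq_top hh hy hcon, EReal.add_top_of_ne_bot (hl.ne_bot x)] at hx
    exact lt_irrefl _ hx
  · by_contra hcon
    rw [eq_top_of_notMem_effDom hcon, EReal.top_add_of_ne_bot (bregmanDiv_ne_bot hh hy)] at hx
    exact lt_irrefl _ hx

lemma lowerSemicontinuous_add_bregmanDiv (hh : IsGammaZero h) (hl : IsGammaZero l) {y : H}
    (hy : y ∈ interior (effDom h)) : LowerSemicontinuous (fun x => l x + bregmanDiv h x y) := by
  have e : (fun x => l x + bregmanDiv h x y) = fun x => l x + (h x +
      ((- finitePart h y - inner ℝ (gradient (finitePart h) y) (x - y) : ℝ) : EReal)) := by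
    funext x
    rw [bregmanDiv, if_pos hy, ← hh.coe_finitePart (interior_subset hy), sub_eq_add_neg,
      sub_eq_add_neg (h x), add_assoc, ← EReal.coe_neg, ← EReal.coe_neg, ← EReal.coe_add]
    rfl
  have hc : LowerSemicontinuous fun x => ((- finitePart h y -
      inner ℝ (gradient (finitePart h) y) (x - y) : ℝ) : EReal) :=
    (continuous_coe_real_ereal.comp (by fun_prop)).lowerSemicontinuous
  rw [e]
  refine hl.lsc.add' (hh.lsc.add' hc fun x => EReal.continuousAt_add ?_ ?_)
    fun x => EReal.continuousAt_add ?_ ?_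
  · exact Or.inr (EReal.coe_ne_bot _)
  · exact Or.inl (hh.ne_bot x)
  · exact Or.inr (EReal.add_ne_bot_iff.2 ⟨hh.ne_bot x, EReal.coe_ne_bot _⟩)
  · exact Or.inl (hl.ne_bot x)

/-- Either the Bregman divergence grows linearly and `l` is bounded below, or `h + l` outgrows the
linear term of the divergence. -/
lemma isBounded_sublevel_add_bregmanDiv [FiniteDimensional ℝ H] (A : BregmanProxAdmissible h l)
    {y : H} (hy : y ∈ interior (effDom h)) (r : ℝ) :
    Bornology.IsBounded {x | l x + bregmanDiv h x y ≤ r} := by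
  obtain ⟨hh, hL, hl, -, hg⟩ := A
  set g := gradient (finitePart h) y with hgdef
  have key : ∀ x, l x + bregmanDiv h x y ≤ r → x ∈ effDom h ∧ x ∈ effDom l ∧
      finitePart l x + (finitePart h x - finitePart h y - inner ℝ g (x - y)) ≤ r := by
    intro x hx
    obtain ⟨h1, h2⟩ := mem_effDom_of_add_bregmanDiv_lt_top hh hl hy
      (hx.trans_lt (EReal.coe_lt_top r))
    rw [add_bregmanDiv_eq_coe hh hl hy h1 h2] at hx
    exact ⟨h1, h2, by exact_mod_cast hx⟩
  obtain ⟨m, hm⟩ | hsc := hg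
  · obtain ⟨ε, hε, δ, hδ, hgrow⟩ := hh.convex.exists_mul_norm_sub_le
      (hh.strictConvexOn_interior hL) hy (hL.smooth.differentiable y hy)
    refine (Metric.isBounded_closedBall (x := y) (r := max ε ((r - m) / δ))).subset fun x hx => ?_
    obtain ⟨h1, h2, h3⟩ := key x hx
    rw [mem_closedBall_iff_norm, le_max_iff]
    by_cases hxε : ‖x - y‖ ≤ ε
    · exact Or.inl hxε
    · right
      have h4 := hgrow x h1 (le_of_not_ge hxε)
      have h5 : m ≤ finitePart l x := by
        have := hm x
        rw [← hl.coe_finitePart h2] at this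
        exact_mod_cast this
      rw [le_div_iff₀ hδ]
      linarith
  -- Of the slope `‖g‖ + 1`, the part `‖g‖` absorbs `⟨g, x⟩` and the rest bounds `‖x‖`.
  · have hev := hsc.eventually (lt_mem_nhds (EReal.coe_lt_top (‖g‖ + 1)))
    obtain ⟨R, -, hR⟩ := hasBasis_cobounded_norm.mem_iff.1 hev
    refine (Metric.isBounded_closedBall (x := (0 : H))
      (r := max (max R 1) (r + finitePart h y - inner ℝ g y))).subset fun x hx => ?_
    obtain ⟨h1, h2, h3⟩ := key x hx
    rw [mem_closedBall_zero_iff, le_max_iff]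
    by_cases hxR : ‖x‖ ≤ max R 1
    · exact Or.inl hxR
    · right
      rw [not_le, max_lt_iff] at hxR
      have h4 : ((‖g‖ + 1 : ℝ) : EReal) < (h x + l x) / (‖x‖ : EReal) := hR hxR.1.le
      rw [← hh.coe_finitePart h1, ← hl.coe_finitePart h2, ← EReal.coe_add, ← EReal.coe_div,
        EReal.coe_lt_coe_iff, lt_div_iff₀ (by linarith [hxR.2])] at h4
      have h5 := real_inner_le_norm g x
      rw [inner_sub_right] at h3
      linarith

/-- A minimizer of `l + D^h(·, y)` lies in the interior of the domain of `h`. -/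
lemma mem_interior_of_isMinimizer [FiniteDimensional ℝ H] (A : BregmanProxAdmissible h l)
    {y p : H} (hy : y ∈ interior (effDom h))
    (hp : ∀ x, l p + bregmanDiv h p y ≤ l x + bregmanDiv h x y) :
    p ∈ interior (effDom h) ∩ effDom l := by
  obtain ⟨hh, hL, hl, ⟨q, hq, hql⟩, -⟩ := A
  have hlt : l p + bregmanDiv h p y < ⊤ := (hp q).trans_lt (by
    rw [add_bregmanDiv_eq_coe hh hl hy (interior_subset hq) hql]; exact EReal.coe_lt_top _)
  obtain ⟨hpd, hpl⟩ := mem_effDom_of_add_bregmanDiv_lt_top hh hl hy hlt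
  refine ⟨?_, hpl⟩
  by_contra hpi
  set g := gradient (finitePart h) y with hgdef
  -- This slope cancels the upper bound on the change of `l` and the change of the linear term from
  -- `p` towards `q`, so the objective strictly decreases.
  obtain ⟨t, ht, hlt⟩ := hh.convex.exists_lt_sub_mul hL.smooth.differentiable hL.smooth.blowup hpd
    hpi hq (finitePart l q - finitePart l p - inner ℝ g (q - p))
  have e : (1 - t) • p + t • q = p + t • (q - p) := by module
  have hxd := interior_subset (hh.convex.1.add_smul_sub_mem_interior hpd hq ht)
  have hxl : p + t • (q - p) ∈ effDom l := by
    rw [← e]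
    exact hl.convex.1 hpl hql (sub_nonneg.2 ht.2) ht.1.le (by ring)
  have hlc := hl.convex.2 hpl hql (sub_nonneg.2 ht.2) ht.1.le (by ring)
  rw [e] at hlc
  have hmin := hp (p + t • (q - p))
  rw [add_bregmanDiv_eq_coe hh hl hy hpd hpl, add_bregmanDiv_eq_coe hh hl hy hxd hxl,
    EReal.coe_le_coe_iff] at hmin
  have e2 : p + t • (q - p) - y = (p - y) + t • (q - p) := by abel
  rw [e2, inner_add_right, inner_smul_right] at hmin
  simp only [smul_eq_mul] at hlc
  linarith

/-- All minimizers lie in the interior, where `h` is strictly convex; the midpoint of two distinct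
ones would do better. -/
lemma isBregmanProx_of_isMinimizer [FiniteDimensional ℝ H] (A : BregmanProxAdmissible h l)
    {y p : H} (hy : y ∈ interior (effDom h))
    (hp : ∀ x, l p + bregmanDiv h p y ≤ l x + bregmanDiv h x y) : IsBregmanProx h l y p := by
  have hpm := mem_interior_of_isMinimizer A hy hp
  refine ⟨hpm, hp, fun q hq => ?_⟩
  have hqm := mem_interior_of_isMinimizer A hy hq
  obtain ⟨hh, hL, hl, -, -⟩ := A
  by_contra hne
  have hhalf : (0 : ℝ) < 1 / 2 := by norm_num
  have hsum : (1 / 2 : ℝ) + 1 / 2 = 1 := by norm_num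
  have hs := (hh.strictConvexOn_interior hL).2 hqm.1 hpm.1 hne hhalf hhalf hsum
  have hlc := hl.convex.2 hqm.2 hpm.2 hhalf.le hhalf.le hsum
  have hmd := hh.convex.1 (interior_subset hqm.1) (interior_subset hpm.1) hhalf.le hhalf.le hsum
  have hml := hl.convex.1 hqm.2 hpm.2 hhalf.le hhalf.le hsum
  have h1 := hp ((1 / 2 : ℝ) • q + (1 / 2 : ℝ) • p)
  have h2 : l q + bregmanDiv h q y ≤ _ := hq ((1 / 2 : ℝ) • q + (1 / 2 : ℝ) • p)
  beta_reduce at h2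
  rw [add_bregmanDiv_eq_coe hh hl hy hmd hml] at h1 h2
  rw [add_bregmanDiv_eq_coe hh hl hy (interior_subset hpm.1) hpm.2, EReal.coe_le_coe_iff] at h1
  rw [add_bregmanDiv_eq_coe hh hl hy (interior_subset hqm.1) hqm.2, EReal.coe_le_coe_iff] at h2
  simp only [inner_sub_right, inner_add_right, inner_smul_right, smul_eq_mul] at h1 h2 hs hlc
  linarith

/-- Existence of the Bregman proximity operator. -/
theorem BregmanProxAdmissible.definedAt [FiniteDimensional ℝ H] (A : BregmanProxAdmissible h l)
    {y : H} (hy : y ∈ interior (effDom h)) : BregmanProxDefinedAt h l y := by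
  refine ⟨A, hy, ?_⟩
  obtain ⟨q, hq, hql⟩ := A.domains
  have hlsc := lowerSemicontinuous_add_bregmanDiv A.gammaZero_left A.gammaZero_right hy
  set r : ℝ := finitePart l q + (finitePart h q - finitePart h y -
      inner ℝ (gradient (finitePart h) y) (q - y))
  have hqr : l q + bregmanDiv h q y = r :=
    add_bregmanDiv_eq_coe A.gammaZero_left A.gammaZero_right hy (interior_subset hq) hql
  -- The level is the finite value at `q`; a minimizer on this compact set is global.
  have hcomp : IsCompact {x | l x + bregmanDiv h x y ≤ r} :=
    Metric.isCompact_of_isClosed_isBounded (hlsc.isClosed_preimage r)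
      (isBounded_sublevel_add_bregmanDiv A hy r)
  obtain ⟨p, hp, hmin⟩ := (hlsc.lowerSemicontinuousOn _).exists_isMinOn ⟨q, hqr.le⟩ hcomp
  refine ⟨p, isBregmanProx_of_isMinimizer A hy fun x => ?_⟩
  by_cases hx : l x + bregmanDiv h x y ≤ r
  · exact hmin hx
  · exact le_trans hp (le_of_not_ge hx)

lemma IsBregmanProx.bregmanProx_eq {y p : H} (hp : IsBregmanProx h l y p) :
    bregmanProx h l y = p := by
  have hex : ∃ p, IsBregmanProx h l y p := ⟨p, hp⟩
  rw [bregmanProx, dif_pos hex]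
  exact hp.2.2 _ hex.choose_spec.2.1

lemma BregmanProxDefinedAt.isBregmanProx {y : H} (hd : BregmanProxDefinedAt h l y) :
    IsBregmanProx h l y (bregmanProx h l y) := by
  obtain ⟨p, hp⟩ := hd.exists_prox
  rwa [hp.bregmanProx_eq]

end GammaZero

/-! ### Spectral decompositions and diagonals of symmetric matrices. -/

noncomputable section

section Spectral

variable {n : ℕ}

/-- The vector `d` with its entries permuted by `σ`. -/
def permuteEntries (σ : Equiv.Perm (Fin n)) (d : EuclideanSpace ℝ (Fin n)) :
    EuclideanSpace ℝ (Fin n) := WithLp.toLp 2 (fun i => d (σ i))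

lemma norm_permuteEntries (σ : Equiv.Perm (Fin n)) (d : EuclideanSpace ℝ (Fin n)) :
    ‖permuteEntries σ d‖ = ‖d‖ := by
  rw [EuclideanSpace.norm_eq, EuclideanSpace.norm_eq]
  congr 1
  exact Equiv.sum_comp σ (fun i => ‖d i‖ ^ 2)

namespace SymMat

lemma toMat_injective : Function.Injective (toMat : SymMat n → Matrix (Fin n) (Fin n) ℝ) :=
  Subtype.val_injective

lemma inner_eq_trace (A B : SymMat n) : inner ℝ A B = (A.toMatᵀ * B.toMat).trace := rfl

/-- `toMat` as a linear map. -/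
def toMatLinear (n : ℕ) : SymMat n →ₗ[ℝ] Matrix (Fin n) (Fin n) ℝ where
  toFun := toMat
  map_add' _ _ := rfl
  map_smul' _ _ := rfl

lemma isClosedEmbedding_toMat :
    IsClosedEmbedding (toMat : SymMat n → Matrix (Fin n) (Fin n) ℝ) :=
  LinearMap.isClosedEmbedding_of_injective (f := toMatLinear n)
    (LinearMap.ker_eq_bot.2 toMat_injective)

/-- The symmetric matrix `U * Diag d * Uᵀ`. -/
def diagConj (U : Matrix (Fin n) (Fin n) ℝ) : EuclideanSpace ℝ (Fin n) →ₗ[ℝ] SymMat n where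
  toFun d := (⟨U * diagonal (fun i => d i) * Uᵀ, by
    change (U * diagonal (fun i => d i) * Uᵀ)ᵀ = _
    simp [Matrix.transpose_mul, Matrix.mul_assoc]⟩ : symSubmodule n)
  map_add' a b := Subtype.ext (by
    change U * diagonal (fun i => a i + b i) * Uᵀ = U * diagonal (fun i => a i) * Uᵀ +
      U * diagonal (fun i => b i) * Uᵀ
    rw [← Matrix.add_mul, ← Matrix.mul_add, diagonal_add])
  map_smul' c a := Subtype.ext (by
    change U * diagonal (c • fun i => a i) * Uᵀ = c • (U * diagonal (fun i => a i) * Uᵀ)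
    rw [diagonal_smul, Matrix.mul_smul, Matrix.smul_mul])

lemma toMat_diagConj (U : Matrix (Fin n) (Fin n) ℝ) (d : EuclideanSpace ℝ (Fin n)) :
    (diagConj U d).toMat = U * diagonal (fun i => d i) * Uᵀ := rfl

/-- The diagonal of `Uᵀ * C * U`. -/
def diagPart (U : Matrix (Fin n) (Fin n) ℝ) : SymMat n →ₗ[ℝ] EuclideanSpace ℝ (Fin n) where
  toFun C := WithLp.toLp 2 (fun i => (Uᵀ * C.toMat * U) i i)
  map_add' A B := by
    ext i
    change (Uᵀ * (A.toMat + B.toMat) * U) i i = (Uᵀ * A.toMat * U) i i + (Uᵀ * B.toMat * U) i i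
    rw [Matrix.mul_add, Matrix.add_mul, Matrix.add_apply]
  map_smul' c A := by
    ext i
    change (Uᵀ * (c • A.toMat) * U) i i = c * (Uᵀ * A.toMat * U) i i
    rw [Matrix.mul_smul, Matrix.smul_mul, Matrix.smul_apply, smul_eq_mul]

lemma diagPart_apply (U : Matrix (Fin n) (Fin n) ℝ) (C : SymMat n) (i : Fin n) :
    diagPart U C i = (Uᵀ * C.toMat * U) i i := rfl

/-- Cyclicity of the trace makes `diagConj U` and `diagPart U` adjoint. -/
lemma inner_diagConj (U : Matrix (Fin n) (Fin n) ℝ) (g : EuclideanSpace ℝ (Fin n))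
    (C : SymMat n) : inner ℝ (diagConj U g) C = inner ℝ g (diagPart U C) := by
  rw [inner_eq_trace, toMat_diagConj, PiLp.inner_apply]
  have e : ((U * diagonal (fun i => g i) * Uᵀ)ᵀ * C.toMat).trace =
      (diagonal (fun i => g i) * (Uᵀ * C.toMat * U)).trace := by
    rw [transpose_mul, transpose_mul, transpose_transpose, diagonal_transpose, Matrix.mul_assoc,
      trace_mul_comm]
    simp only [Matrix.mul_assoc]
  rw [e, trace]
  refine Finset.sum_congr rfl fun i _ => ?_
  rw [diag_apply, diagonal_mul, diagPart_apply]
  simp [mul_comm]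

lemma diagPart_diagConj {U : Matrix (Fin n) (Fin n) ℝ} (hU : U ∈ orthogonalGroup (Fin n) ℝ)
    (d : EuclideanSpace ℝ (Fin n)) : diagPart U (diagConj U d) = d := by
  rw [mem_orthogonalGroup_iff'] at hU
  ext i
  rw [diagPart_apply, toMat_diagConj]
  have e : Uᵀ * (U * diagonal (fun i => d i) * Uᵀ) * U =
      (Uᵀ * U) * diagonal (fun i => d i) * (Uᵀ * U) := by simp only [Matrix.mul_assoc]
  rw [e, hU, Matrix.one_mul, Matrix.mul_one, diagonal_apply_eq]

lemma norm_diagConj {U : Matrix (Fin n) (Fin n) ℝ} (hU : U ∈ orthogonalGroup (Fin n) ℝ)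
    (d : EuclideanSpace ℝ (Fin n)) : ‖diagConj U d‖ = ‖d‖ := by
  rw [← sq_eq_sq₀ (norm_nonneg _) (norm_nonneg _), ← real_inner_self_eq_norm_sq,
    ← real_inner_self_eq_norm_sq, inner_diagConj, diagPart_diagConj hU]

/-- A symmetric matrix with the norm of its diagonal in an orthonormal basis is diagonal there. -/
lemma eq_diagConj_of_norm_eq {U : Matrix (Fin n) (Fin n) ℝ} (hU : U ∈ orthogonalGroup (Fin n) ℝ)
    {C : SymMat n} (hC : ‖diagPart U C‖ = ‖C‖) : C = diagConj U (diagPart U C) := by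
  -- By Pythagoras the squared distance is `‖C‖ ^ 2 - ‖diagPart U C‖ ^ 2`.
  rw [← sub_eq_zero, ← norm_eq_zero, ← sq_eq_zero_iff, norm_sub_sq_real, real_inner_comm,
    inner_diagConj, norm_diagConj hU, real_inner_self_eq_norm_sq, hC]
  ring

lemma exists_eq_diagConj (C : SymMat n) :
    ∃ U ∈ orthogonalGroup (Fin n) ℝ, ∃ d, C = diagConj U d := by
  have hC : C.toMat.IsHermitian := by
    rw [IsHermitian, conjTranspose_eq_transpose_of_trivial]
    exact C.2
  refine ⟨hC.eigenvectorUnitary, hC.eigenvectorUnitary.2, WithLp.toLp 2 hC.eigenvalues,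
    toMat_injective ?_⟩
  have := hC.spectral_theorem
  rw [Unitary.conjStarAlgAut_apply] at this
  exact this

lemma isEigenvalueVector_diagConj {U : Matrix (Fin n) (Fin n) ℝ}
    (hU : U ∈ orthogonalGroup (Fin n) ℝ) (d : EuclideanSpace ℝ (Fin n)) :
    IsEigenvalueVector (diagConj U d) d := by
  rw [mem_orthogonalGroup_iff'] at hU
  rw [IsEigenvalueVector, toMat_diagConj, charpoly_mul_comm, ← Matrix.mul_assoc, hU,
    Matrix.one_mul, charpoly_diagonal, Finset.prod_eq_multiset_prod]
  have := Polynomial.roots_multiset_prod_X_sub_C (Finset.univ.val.map (fun i => d i))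
  rwa [Multiset.map_map] at this

/-- The diagonal of a symmetric matrix, in any orthonormal basis, is a convex combination of
permutations of the vector of eigenvalues. -/
lemma diagPart_diagConj_mem_convexHull {U V : Matrix (Fin n) (Fin n) ℝ}
    (hU : U ∈ orthogonalGroup (Fin n) ℝ) (hV : V ∈ orthogonalGroup (Fin n) ℝ)
    (d : EuclideanSpace ℝ (Fin n)) :
    diagPart U (diagConj V d) ∈ convexHull ℝ (range fun σ => permuteEntries σ d) := by
  set W := Uᵀ * V with hW
  have hWO : W ∈ orthogonalGroup (Fin n) ℝ :=
    mul_mem ((mem_orthogonalGroup_iff _ _).2 (by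
      rw [transpose_transpose]
      exact (mem_orthogonalGroup_iff' _ _).1 hU)) hV
  have hS : (of fun i j => W i j * W i j) ∈ doublyStochastic ℝ (Fin n) := by
    rw [mem_doublyStochastic_iff_sum]
    refine ⟨fun i j => mul_self_nonneg _, fun i => ?_, fun j => ?_⟩
    · have := congrFun (congrFun ((mem_orthogonalGroup_iff _ _).1 hWO) i) i
      simpa [mul_apply] using this
    · have := congrFun (congrFun ((mem_orthogonalGroup_iff' _ _).1 hWO) j) j
      simpa [mul_apply] using this
  -- The map `M ↦ M d` is linear, so it carries Birkhoff's hull of permutation matrices to the hull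
  -- of the permutations of `d`.
  let L : Matrix (Fin n) (Fin n) ℝ →ₗ[ℝ] EuclideanSpace ℝ (Fin n) :=
    { toFun M := WithLp.toLp 2 (M *ᵥ fun j => d j)
      map_add' A B := by rw [add_mulVec]; rfl
      map_smul' c A := by rw [smul_mulVec]; rfl }
  have hL : diagPart U (diagConj V d) = L (of fun i j => W i j * W i j) := by
    ext i
    have e : Uᵀ * (V * diagonal (fun i => d i) * Vᵀ) * U = W * diagonal (fun i => d i) * Wᵀ := by
      rw [hW, transpose_mul, transpose_transpose]
      simp only [Matrix.mul_assoc]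
    change _ = ∑ j, W i j * W i j * d j
    rw [diagPart_apply, toMat_diagConj, e, mul_apply]
    refine Finset.sum_congr rfl fun j _ => ?_
    rw [mul_diagonal, transpose_apply]
    ring
  rw [← SetLike.mem_coe, doublyStochastic_eq_convexHull_permMatrix] at hS
  have := mem_image_of_mem L hS
  rw [L.image_convexHull, ← hL] at this
  refine convexHull_mono ?_ this
  rintro _ ⟨_, ⟨σ, rfl⟩, rfl⟩
  refine ⟨σ, ?_⟩
  change _ = WithLp.toLp 2 (Equiv.Perm.permMatrix ℝ σ *ᵥ fun j => d j)
  rw [permMatrix_mulVec]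
  rfl

lemma continuous_diagConj (U : Matrix (Fin n) (Fin n) ℝ) : Continuous (diagConj U) :=
  (diagConj U).continuous_of_finiteDimensional

lemma tendsto_diagConj {ι : Type*} {k : Filter ι} {U : ι → Matrix (Fin n) (Fin n) ℝ}
    {d : ι → EuclideanSpace ℝ (Fin n)} {U₀ : Matrix (Fin n) (Fin n) ℝ}
    {d₀ : EuclideanSpace ℝ (Fin n)} (hU : Tendsto U k (𝓝 U₀)) (hd : Tendsto d k (𝓝 d₀)) :
    Tendsto (fun i => diagConj (U i) (d i)) k (𝓝 (diagConj U₀ d₀)) := by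
  rw [isClosedEmbedding_toMat.tendsto_nhds_iff]
  have hc : Continuous fun p : Matrix (Fin n) (Fin n) ℝ × EuclideanSpace ℝ (Fin n) =>
      p.1 * diagonal (fun i => p.2 i) * p.1ᵀ :=
    (continuous_fst.matrix_mul (Continuous.matrix_diagonal (by fun_prop))).matrix_mul
      continuous_fst.matrix_transpose
  have h := (hc.tendsto (U₀, d₀)).comp (hU.prodMk_nhds hd)
  simp only [Function.comp_def] at h
  simpa only [Function.comp_def, toMat_diagConj] using h

lemma isCompact_orthogonalGroup :
    IsCompact (orthogonalGroup (Fin n) ℝ : Set (Matrix (Fin n) (Fin n) ℝ)) := by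
  have hc : IsCompact {U : Matrix (Fin n) (Fin n) ℝ | ∀ i j, U i j ∈ Icc (-1 : ℝ) 1} := by
    have h1 : IsCompact {U : Fin n → Fin n → ℝ |
        ∀ i, U i ∈ {v : Fin n → ℝ | ∀ j, v j ∈ Icc (-1) 1}} :=
      isCompact_pi_infinite fun _ => isCompact_pi_infinite fun _ => isCompact_Icc
    exact h1
  refine hc.of_isClosed_subset ?_ ?_
  · have e : (orthogonalGroup (Fin n) ℝ : Set (Matrix (Fin n) (Fin n) ℝ)) = {U | U * Uᵀ = 1} := by
      ext U
      exact mem_orthogonalGroup_iff _ _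
    rw [e]
    exact isClosed_eq (continuous_id.matrix_mul continuous_id.matrix_transpose) continuous_const
  · intro U hU i j
    have := entry_norm_bound_of_unitary hU i j
    rwa [Real.norm_eq_abs, abs_le] at this

/-- A convergent sequence of symmetric matrices has a subsequence along which given spectral
decompositions converge. -/
lemma exists_subseq_tendsto {U : ℕ → Matrix (Fin n) (Fin n) ℝ}
    (hU : ∀ k, U k ∈ orthogonalGroup (Fin n) ℝ) {d : ℕ → EuclideanSpace ℝ (Fin n)} {C : SymMat n}
    (hC : Tendsto (fun k => diagConj (U k) (d k)) atTop (𝓝 C)) :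
    ∃ U₀ ∈ orthogonalGroup (Fin n) ℝ, ∃ d₀, C = diagConj U₀ d₀ ∧ ∃ ms : ℕ → ℕ, StrictMono ms ∧
      Tendsto (U ∘ ms) atTop (𝓝 U₀) ∧ Tendsto (d ∘ ms) atTop (𝓝 d₀) := by
  have : FirstCountableTopology (Matrix (Fin n) (Fin n) ℝ) :=
    inferInstanceAs (FirstCountableTopology (Fin n → Fin n → ℝ))
  obtain ⟨R, hR⟩ := (Metric.isBounded_range_of_tendsto _ hC).exists_norm_le
  have hd : ∀ k, d k ∈ Metric.closedBall 0 R := fun k => by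
    rw [mem_closedBall_zero_iff, ← norm_diagConj (hU k)]
    exact hR _ (mem_range_self k)
  obtain ⟨⟨U₀, d₀⟩, hmem, ms, hms, hlim⟩ :=
    (isCompact_orthogonalGroup.prod (isCompact_closedBall (0 : EuclideanSpace ℝ (Fin n)) R)
      ).tendsto_subseq (x := fun k => (U k, d k)) fun k => ⟨hU k, hd k⟩
  have h1 : Tendsto (U ∘ ms) atTop (𝓝 U₀) := (continuous_fst.tendsto _).comp hlim
  have h2 : Tendsto (d ∘ ms) atTop (𝓝 d₀) := (continuous_snd.tendsto _).comp hlim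
  exact ⟨U₀, hmem.1, d₀, tendsto_nhds_unique (hC.comp hms.tendsto_atTop) (tendsto_diagConj h1 h2),
    ms, hms, h1, h2⟩

/-- Used for lower semicontinuity and for identifying the interior of the domain of `f`; the
eigenvalues need no continuous ordering. -/
lemma isClosed_setOf_diagConj {K : Set (EuclideanSpace ℝ (Fin n))} (hK : IsClosed K) :
    IsClosed {C : SymMat n | ∃ U ∈ orthogonalGroup (Fin n) ℝ, ∃ d ∈ K, C = diagConj U d} := by
  refine IsSeqClosed.isClosed fun C C₀ hC hlim => ?_
  choose U hU d hd hCd using hC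
  obtain rfl : C = fun k => diagConj (U k) (d k) := funext hCd
  obtain ⟨U₀, hU₀, d₀, rfl, ms, -, -, hdl⟩ := exists_subseq_tendsto hU hlim
  exact ⟨U₀, hU₀, d₀, hK.mem_of_tendsto hdl (Eventually.of_forall fun k => hd _), rfl⟩

end SymMat

end Spectral

end

/-! ### Transfer of convexity, gradients and proximal points to spectral functions. -/

noncomputable section

section SpectralFunctions

open SymMat

variable {n : ℕ} {φ ψ : EuclideanSpace ℝ (Fin n) → EReal} {f g₀ : SymMat n → EReal}
  {U V : Matrix (Fin n) (Fin n) ℝ} {d : EuclideanSpace ℝ (Fin n)}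

namespace IsSpectralOf

lemma apply_diagConj (hf : IsSpectralOf f φ) (hU : U ∈ orthogonalGroup (Fin n) ℝ)
    (d : EuclideanSpace ℝ (Fin n)) : f (diagConj U d) = φ d :=
  hf _ d (isEigenvalueVector_diagConj hU d) 1

lemma apply_permuteEntries (hf : IsSpectralOf f φ) (σ : Equiv.Perm (Fin n))
    (d : EuclideanSpace ℝ (Fin n)) : φ (permuteEntries σ d) = φ d := by
  rw [← hf.apply_diagConj (one_mem _) d]
  exact (hf _ d (isEigenvalueVector_diagConj (one_mem _) d) σ).symm

lemma finitePart_diagConj (hf : IsSpectralOf f φ) (hU : U ∈ orthogonalGroup (Fin n) ℝ)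
    (d : EuclideanSpace ℝ (Fin n)) : finitePart f (diagConj U d) = finitePart φ d := by
  rw [finitePart, hf.apply_diagConj hU, finitePart]

lemma diagConj_mem_effDom (hf : IsSpectralOf f φ) (hU : U ∈ orthogonalGroup (Fin n) ℝ) :
    diagConj U d ∈ effDom f ↔ d ∈ effDom φ := by
  change f (diagConj U d) < ⊤ ↔ φ d < ⊤
  rw [hf.apply_diagConj hU]

lemma permuteEntries_mem_effDom (hf : IsSpectralOf f φ) (σ : Equiv.Perm (Fin n)) :
    permuteEntries σ d ∈ effDom φ ↔ d ∈ effDom φ := by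
  change φ (permuteEntries σ d) < ⊤ ↔ φ d < ⊤
  rw [hf.apply_permuteEntries]

lemma permuteEntries_mem_interior (hf : IsSpectralOf f φ) (σ : Equiv.Perm (Fin n))
    (hd : d ∈ interior (effDom φ)) : permuteEntries σ d ∈ interior (effDom φ) := by
  have hc : Continuous (permuteEntries (n := n) σ⁻¹) := by
    unfold permuteEntries
    fun_prop
  refine interior_maximal (t := permuteEntries σ⁻¹ ⁻¹' interior (effDom φ)) (fun x hx => ?_)
    (isOpen_interior.preimage hc) ?_
  · exact (hf.permuteEntries_mem_effDom σ⁻¹).1 (interior_subset hx)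
  · have e : permuteEntries σ⁻¹ (permuteEntries σ d) = d := by
      ext i
      simp [permuteEntries]
    rwa [mem_preimage, e]

/-- Passing to the diagonal in an orthonormal basis does not increase a spectral function. -/
lemma diagPart_le (hf : IsSpectralOf f φ) (hφ : IsGammaZero φ)
    (hU : U ∈ orthogonalGroup (Fin n) ℝ) {C : SymMat n} (hC : C ∈ effDom f) :
    diagPart U C ∈ effDom φ ∧ finitePart φ (diagPart U C) ≤ finitePart f C := by
  obtain ⟨V, hV, d, rfl⟩ := exists_eq_diagConj C
  rw [hf.diagConj_mem_effDom hV] at hC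
  rw [hf.finitePart_diagConj hV]
  refine convexHull_min ?_ (hφ.convex.convex_le (finitePart φ d))
    (diagPart_diagConj_mem_convexHull hU hV d)
  rintro _ ⟨σ, rfl⟩
  exact ⟨(hf.permuteEntries_mem_effDom σ).2 hC,
    by rw [finitePart, hf.apply_permuteEntries, finitePart]⟩

lemma diagPart_diagConj_mem_interior (hf : IsSpectralOf f φ) (hφ : IsGammaZero φ)
    (hU : U ∈ orthogonalGroup (Fin n) ℝ) (hV : V ∈ orthogonalGroup (Fin n) ℝ)
    (hd : d ∈ interior (effDom φ)) : diagPart U (diagConj V d) ∈ interior (effDom φ) := by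
  refine convexHull_min ?_ hφ.convex.1.interior (diagPart_diagConj_mem_convexHull hU hV d)
  rintro _ ⟨σ, rfl⟩
  exact hf.permuteEntries_mem_interior σ hd

lemma diagConj_mem_interior (hf : IsSpectralOf f φ) (hφ : IsGammaZero φ)
    (hU : U ∈ orthogonalGroup (Fin n) ℝ) :
    diagConj U d ∈ interior (effDom f) ↔ d ∈ interior (effDom φ) := by
  constructor
  · intro h
    exact interior_maximal (t := diagConj U ⁻¹' interior (effDom f))
      (fun x hx => (hf.diagConj_mem_effDom hU).1 (interior_subset hx))
      (isOpen_interior.preimage (continuous_diagConj U)) h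
  · intro h
    -- The open set consists of the matrices none of whose decompositions has its eigenvalue vector
    -- outside the interior.
    refine interior_maximal (t := {C : SymMat n | ∃ U ∈ orthogonalGroup (Fin n) ℝ,
      ∃ d ∈ (interior (effDom φ))ᶜ, C = diagConj U d}ᶜ) (fun C hC => ?_)
      (isClosed_setOf_diagConj isOpen_interior.isClosed_compl).isOpen_compl ?_
    · obtain ⟨V, hV, x, rfl⟩ := exists_eq_diagConj C
      rw [hf.diagConj_mem_effDom hV]
      by_contra hx
      exact hC ⟨V, hV, x, fun h => hx (interior_subset h), rfl⟩
    · rintro ⟨V, hV, x, hx, hUV⟩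
      refine hx ?_
      rw [← diagPart_diagConj hV x, ← hUV]
      exact hf.diagPart_diagConj_mem_interior hφ hV hU h

lemma diagPart_mem_interior (hf : IsSpectralOf f φ) (hφ : IsGammaZero φ)
    (hU : U ∈ orthogonalGroup (Fin n) ℝ) {C : SymMat n} (hC : C ∈ interior (effDom f)) :
    diagPart U C ∈ interior (effDom φ) := by
  obtain ⟨V, hV, d, rfl⟩ := exists_eq_diagConj C
  exact hf.diagPart_diagConj_mem_interior hφ hU hV ((hf.diagConj_mem_interior hφ hV).1 hC)

/-- Spectral functions inherit membership in `Γ₀`. -/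
theorem isGammaZero (hf : IsSpectralOf f φ) (hφ : IsGammaZero φ) : IsGammaZero f where
  ne_bot C := by
    obtain ⟨U, hU, d, rfl⟩ := exists_eq_diagConj C
    rw [hf.apply_diagConj hU]
    exact hφ.ne_bot d
  proper := by
    obtain ⟨d, hd⟩ := hφ.proper
    exact ⟨diagConj 1 d, (hf.diagConj_mem_effDom (one_mem _)).2 hd⟩
  lsc := by
    rw [lowerSemicontinuous_iff_isClosed_preimage]
    intro r
    convert isClosed_setOf_diagConj (hφ.lsc.isClosed_preimage r) using 1
    ext C
    constructor
    · intro hC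
      obtain ⟨U, hU, d, rfl⟩ := exists_eq_diagConj C
      rw [mem_preimage, hf.apply_diagConj hU] at hC
      exact ⟨U, hU, d, hC, rfl⟩
    · rintro ⟨U, hU, d, hd, rfl⟩
      rw [mem_preimage, hf.apply_diagConj hU]
      exact hd
  convex := by
    have key : ∀ A ∈ effDom f, ∀ B ∈ effDom f, ∀ a b : ℝ, 0 ≤ a → 0 ≤ b → a + b = 1 →
        a • A + b • B ∈ effDom f ∧
          finitePart f (a • A + b • B) ≤ a • finitePart f A + b • finitePart f B := by
      intro A hA B hB a b ha hb hab
      -- In a basis that diagonalises the combination, its eigenvalues are the same combination of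
      -- the diagonals of `A` and `B`.
      obtain ⟨U, hU, d, hd⟩ := exists_eq_diagConj (a • A + b • B)
      have hde : d = a • diagPart U A + b • diagPart U B := by
        rw [← map_smul, ← map_smul, ← map_add, hd, diagPart_diagConj hU]
      obtain ⟨hA1, hA2⟩ := hf.diagPart_le hφ hU hA
      obtain ⟨hB1, hB2⟩ := hf.diagPart_le hφ hU hB
      rw [hd, hf.diagConj_mem_effDom hU, hf.finitePart_diagConj hU, hde]
      refine ⟨hφ.convex.1 hA1 hB1 ha hb hab, (hφ.convex.2 hA1 hB1 ha hb hab).trans ?_⟩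
      gcongr
    exact ⟨fun A hA B hB a b ha hb hab => (key A hA B hB a b ha hb hab).1,
      fun A hA B hB a b ha hb hab => (key A hA B hB a b ha hb hab).2⟩

lemma diagConj_mem_subdiff (hf : IsSpectralOf f φ) (hφ : IsGammaZero φ)
    (hU : U ∈ orthogonalGroup (Fin n) ℝ) (hd : d ∈ effDom φ) {g : EuclideanSpace ℝ (Fin n)}
    (hg : g ∈ subdiff φ d) : diagConj U g ∈ subdiff f (diagConj U d) := by
  rw [(hf.isGammaZero hφ).mem_subdiff_iff ((hf.diagConj_mem_effDom hU).2 hd)]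
  intro C hC
  obtain ⟨h1, h2⟩ := hf.diagPart_le hφ hU hC
  rw [inner_diagConj, map_sub, diagPart_diagConj hU, hf.finitePart_diagConj hU]
  exact ((hφ.mem_subdiff_iff hd).1 hg _ h1).trans h2

lemma diagPart_mem_subdiff (hf : IsSpectralOf f φ) (hφ : IsGammaZero φ)
    (hU : U ∈ orthogonalGroup (Fin n) ℝ) {G : SymMat n}
    (hG : G ∈ subdiff f (diagConj U d)) : diagPart U G ∈ subdiff φ d := by
  have hd := (hf.isGammaZero hφ).mem_effDom_of_subdiff ⟨G, hG⟩
  rw [(hf.isGammaZero hφ).mem_subdiff_iff hd] at hG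
  rw [hf.diagConj_mem_effDom hU] at hd
  rw [hφ.mem_subdiff_iff hd]
  intro w hw
  have h := hG _ ((hf.diagConj_mem_effDom hU).2 hw)
  rwa [hf.finitePart_diagConj hU, hf.finitePart_diagConj hU, ← map_sub, real_inner_comm,
    inner_diagConj, real_inner_comm] at h

/-- The matrix built from `V` is a subgradient of `f`, so its diagonal in the basis `U` is a
subgradient of `φ` at `x`, where only the gradient is one. -/
lemma diagPart_diagConj_gradient (hf : IsSpectralOf f φ) (hφ : IsGammaZero φ)
    (hs : IsEssSmooth φ) (hU : U ∈ orthogonalGroup (Fin n) ℝ)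
    (hV : V ∈ orthogonalGroup (Fin n) ℝ) {x z : EuclideanSpace ℝ (Fin n)}
    (hx : x ∈ interior (effDom φ)) (hz : z ∈ interior (effDom φ))
    (h : diagConj U x = diagConj V z) :
    diagPart U (diagConj V (gradient (finitePart φ) z)) = gradient (finitePart φ) x := by
  have h1 : diagConj V (gradient (finitePart φ) z) ∈ subdiff f (diagConj U x) := by
    rw [h]
    exact hf.diagConj_mem_subdiff hφ hV (interior_subset hz)
      (hφ.gradient_mem_subdiff (interior_subset hz) (hs.differentiable z hz))
  have h2 := (hφ.mem_subdiff_iff (interior_subset hx)).1 (hf.diagPart_mem_subdiff hφ hU h1)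
  refine eq_gradient_of_eventually_le (hs.differentiable x hx) ?_
  filter_upwards [isOpen_interior.mem_nhds hx] with w hw
  exact h2 w (interior_subset hw)

/-- The matrix `U * Diag (∇φ x) * Uᵀ` depends only on `U * Diag x * Uᵀ`. -/
lemma diagConj_gradient_eq (hf : IsSpectralOf f φ) (hφ : IsGammaZero φ)
    (hs : IsEssSmooth φ) (hU : U ∈ orthogonalGroup (Fin n) ℝ)
    (hV : V ∈ orthogonalGroup (Fin n) ℝ) {x z : EuclideanSpace ℝ (Fin n)}
    (hx : x ∈ interior (effDom φ)) (hz : z ∈ interior (effDom φ))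
    (h : diagConj U x = diagConj V z) :
    diagConj U (gradient (finitePart φ) x) = diagConj V (gradient (finitePart φ) z) := by
  have h1 := hf.diagPart_diagConj_gradient hφ hs hU hV hx hz h
  have h2 := hf.diagPart_diagConj_gradient hφ hs hV hU hz hx h.symm
  -- The inner product of the two matrices equals the squared norm of each, so their distance
  -- vanishes.
  have i1 : inner ℝ (diagConj U (gradient (finitePart φ) x))
      (diagConj V (gradient (finitePart φ) z)) = ‖gradient (finitePart φ) x‖ ^ 2 := by
    rw [inner_diagConj, h1, real_inner_self_eq_norm_sq]
  have i2 : inner ℝ (diagConj U (gradient (finitePart φ) x))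
      (diagConj V (gradient (finitePart φ) z)) = ‖gradient (finitePart φ) z‖ ^ 2 := by
    rw [real_inner_comm, inner_diagConj, h2, real_inner_self_eq_norm_sq]
  rw [← sub_eq_zero, ← norm_eq_zero, ← sq_eq_zero_iff, norm_sub_sq_real, norm_diagConj hU,
    norm_diagConj hV]
  linarith

/-- The gradient of a spectral function. -/
theorem hasGradientAt (hf : IsSpectralOf f φ) (hφ : IsGammaZero φ) (hs : IsEssSmooth φ)
    (hU : U ∈ orthogonalGroup (Fin n) ℝ) {x : EuclideanSpace ℝ (Fin n)}
    (hx : x ∈ interior (effDom φ)) :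
    HasGradientAt (finitePart f) (diagConj U (gradient (finitePart φ) x)) (diagConj U x) := by
  -- This choice of decompositions need not be continuous, but `G` does not depend on it.
  choose W hW e hWe using fun C : SymMat n => exists_eq_diagConj C
  set G : SymMat n → SymMat n := fun C => diagConj (W C) (gradient (finitePart φ) (e C)) with hG
  have he : ∀ C ∈ interior (effDom f), e C ∈ interior (effDom φ) := fun C hC => by
    rw [hWe C] at hC
    exact (hf.diagConj_mem_interior hφ (hW C)).1 hC
  have hGeq : ∀ {Q : Matrix (Fin n) (Fin n) ℝ} {z : EuclideanSpace ℝ (Fin n)},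
      Q ∈ orthogonalGroup (Fin n) ℝ → z ∈ interior (effDom φ) →
      G (diagConj Q z) = diagConj Q (gradient (finitePart φ) z) := fun {Q z} hQ hz =>
    hf.diagConj_gradient_eq hφ hs (hW _) hQ
      (he _ ((hf.diagConj_mem_interior hφ hQ).2 hz)) hz (hWe _).symm
  have hX := (hf.diagConj_mem_interior hφ hU).2 hx
  rw [← hGeq hU hx]
  refine hasGradientAt_of_continuousAt_subgradient (isOpen_interior.mem_nhds hX) (G := G)
    (fun A hA B hB => ?_) ?_
  · have hA' := he A hA
    have h1 := hf.diagConj_mem_subdiff hφ (hW A) (interior_subset hA')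
      (hφ.gradient_mem_subdiff (interior_subset hA') (hs.differentiable _ hA'))
    rw [← hWe A] at h1
    exact ((hf.isGammaZero hφ).mem_subdiff_iff (interior_subset hA)).1 h1 B (interior_subset hB)
  · refine tendsto_of_seq_tendsto fun C hC => tendsto_of_subseq_tendsto fun ns hns => ?_
    have hlim : Tendsto (fun k => diagConj (W (C (ns k))) (e (C (ns k)))) atTop
        (𝓝 (diagConj U x)) := by
      simp only [← hWe]
      exact hC.comp hns
    obtain ⟨U₀, hU₀, x₀, hX₀, ms, -, hUl, hxl⟩ := exists_subseq_tendsto (fun k => hW _) hlim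
    rw [hX₀] at hX ⊢
    have hx₀ := (hf.diagConj_mem_interior hφ hU₀).1 hX
    refine ⟨ms, ?_⟩
    rw [hGeq hU₀ hx₀]
    exact tendsto_diagConj hUl
      ((hφ.convex.continuousAt_gradient hs.differentiable hx₀).tendsto.comp hxl)

lemma isEssSmooth (hf : IsSpectralOf f φ) (hφ : IsGammaZero φ) (hs : IsEssSmooth φ) :
    IsEssSmooth f where
  nonempty := by
    obtain ⟨x, hx⟩ := hs.nonempty
    exact ⟨diagConj 1 x, (hf.diagConj_mem_interior hφ (one_mem _)).2 hx⟩
  differentiable C hC := by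
    obtain ⟨U, hU, x, rfl⟩ := exists_eq_diagConj C
    exact (hf.hasGradientAt hφ hs hU ((hf.diagConj_mem_interior hφ hU).1 hC)).differentiableAt
  blowup := by
    intro C X hC hX hlim
    choose W hW e hWe using fun k => exists_eq_diagConj (C k)
    obtain rfl : C = fun k => diagConj (W k) (e k) := funext hWe
    have he : ∀ k, e k ∈ interior (effDom φ) := fun k =>
      (hf.diagConj_mem_interior hφ (hW k)).1 (hC k)
    have hnorm : ∀ k, ‖gradient (finitePart f) (diagConj (W k) (e k))‖ =
        ‖gradient (finitePart φ) (e k)‖ := fun k => by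
      rw [(hf.hasGradientAt hφ hs (hW k) (he k)).gradient, norm_diagConj (hW k)]
    simp only [hnorm]
    refine tendsto_of_subseq_tendsto fun ns hns => ?_
    obtain ⟨U₀, hU₀, x₀, hX₀, ms, -, -, hxl⟩ :=
      exists_subseq_tendsto (fun k => hW (ns k)) (hlim.comp hns)
    refine ⟨ms, hs.blowup _ x₀ (fun k => he _) ⟨?_, ?_⟩ hxl⟩
    · exact mem_closure_of_tendsto hxl (Eventually.of_forall fun k => interior_subset (he _))
    · intro hx₀
      exact hX.2 (hX₀ ▸ (hf.diagConj_mem_interior hφ hU₀).2 hx₀)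

/-- Off-diagonal entries make the inequality between a spectral function and its value at the
diagonal strict. -/
lemma diagPart_lt (hf : IsSpectralOf f φ) (hφ : IsGammaZero φ) (hL : IsLegendre φ)
    (hU : U ∈ orthogonalGroup (Fin n) ℝ) {C : SymMat n} (hC : C ∈ interior (effDom f))
    (hne : C ≠ diagConj U (diagPart U C)) :
    finitePart φ (diagPart U C) < finitePart f C := by
  obtain ⟨V, hV, d, rfl⟩ := exists_eq_diagConj C
  rw [hf.diagConj_mem_interior hφ hV] at hC
  rw [hf.finitePart_diagConj hV]
  have hsc := hφ.strictConvexOn_interior hL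
  -- `T` is the sublevel set of `d` with equality allowed only at norm `‖d‖`. Strict convexity keeps
  -- it convex, and it contains all permutations of `d`.
  set T : Set (EuclideanSpace ℝ (Fin n)) := {x | x ∈ interior (effDom φ) ∧
    finitePart φ x ≤ finitePart φ d ∧ (‖x‖ ≠ ‖d‖ → finitePart φ x < finitePart φ d)} with hT
  have hTc : Convex ℝ T := by
    rw [convex_iff_pairwise_pos]
    intro x hx z hz hxz a b ha hb hab
    have hlt : finitePart φ (a • x + b • z) < finitePart φ d := by
      refine (hsc.2 hx.1 hz.1 hxz ha hb hab).trans_le ?_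
      calc a • finitePart φ x + b • finitePart φ z
          ≤ a • finitePart φ d + b • finitePart φ d := by gcongr; exacts [hx.2.1, hz.2.1]
        _ = finitePart φ d := by rw [← add_smul, hab, one_smul]
    exact ⟨hsc.1 hx.1 hz.1 ha.le hb.le hab, hlt.le, fun _ => hlt⟩
  have hmem : diagPart U (diagConj V d) ∈ T := by
    refine convexHull_min ?_ hTc (diagPart_diagConj_mem_convexHull hU hV d)
    rintro _ ⟨σ, rfl⟩
    exact ⟨hf.permuteEntries_mem_interior σ hC, by rw [finitePart, hf.apply_permuteEntries,
      finitePart], fun h => absurd (norm_permuteEntries σ d) h⟩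
  refine hmem.2.2 fun h => hne (eq_diagConj_of_norm_eq hU ?_)
  rw [h, norm_diagConj hV]

lemma isEssStrictlyConvex (hf : IsSpectralOf f φ) (hφ : IsGammaZero φ) (hL : IsLegendre φ) :
    IsEssStrictlyConvex f := by
  intro K hK hKc
  have hKi : ∀ C ∈ K, C ∈ interior (effDom f) := by
    intro C hC
    obtain ⟨G, hG⟩ := hK hC
    obtain ⟨U, hU, x, rfl⟩ := exists_eq_diagConj C
    exact (hf.diagConj_mem_interior hφ hU).2
      (hφ.mem_interior_of_subdiff hL.smooth ⟨_, hf.diagPart_mem_subdiff hφ hU hG⟩)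
  refine ⟨hKc, fun A hA B hB hAB a b ha hb hab => ?_⟩
  obtain ⟨U, hU, d, hd⟩ := exists_eq_diagConj (a • A + b • B)
  have hde : d = a • diagPart U A + b • diagPart U B := by
    rw [← map_smul, ← map_smul, ← map_add, hd, diagPart_diagConj hU]
  have hA1 := hf.diagPart_mem_interior hφ hU (hKi A hA)
  have hB1 := hf.diagPart_mem_interior hφ hU (hKi B hB)
  have hA2 := (hf.diagPart_le hφ hU (interior_subset (hKi A hA))).2
  have hB2 := (hf.diagPart_le hφ hU (interior_subset (hKi B hB))).2
  have hA3 := mul_le_mul_of_nonneg_left hA2 ha.le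
  have hB3 := mul_le_mul_of_nonneg_left hB2 hb.le
  rw [hd, hf.finitePart_diagConj hU, hde]
  -- If the diagonals agree, `A ≠ B` forces one of the two to be non-diagonal in this basis, and
  -- strictness comes from `diagPart_lt` instead of from `φ`.
  by_cases hne : diagPart U A = diagPart U B
  · have hle := hφ.convex.2 (interior_subset hA1) (interior_subset hB1) ha.le hb.le hab
    simp only [smul_eq_mul] at hle ⊢
    by_cases hAd : A = diagConj U (diagPart U A)
    · have hBd : B ≠ diagConj U (diagPart U B) := fun h => hAB (by rw [hAd, h, hne])
      have := mul_lt_mul_of_pos_left (hf.diagPart_lt hφ hL hU (hKi B hB) hBd) hb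
      linarith
    · have := mul_lt_mul_of_pos_left (hf.diagPart_lt hφ hL hU (hKi A hA) hAd) ha
      linarith
  · have hlt := (hφ.strictConvexOn_interior hL).2 hA1 hB1 hne ha hb hab
    simp only [smul_eq_mul] at hlt ⊢
    linarith

/-- Spectral functions induced by Legendre functions are Legendre. -/
theorem isLegendre (hf : IsSpectralOf f φ) (hφ : IsGammaZero φ) (hL : IsLegendre φ) :
    IsLegendre f :=
  ⟨hf.isEssSmooth hφ hL.smooth, hf.isEssStrictlyConvex hφ hL⟩

lemma isBddBelow (hf : IsSpectralOf f φ) (hφ : IsBddBelow φ) : IsBddBelow f := by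
  obtain ⟨m, hm⟩ := hφ
  refine ⟨m, fun C => ?_⟩
  obtain ⟨U, hU, d, rfl⟩ := exists_eq_diagConj C
  rw [hf.apply_diagConj hU]
  exact hm d

/-- Eigenvalue vectors have the Frobenius norm of their matrix, so they go to infinity with it. -/
lemma isSupercoercive (hf : IsSpectralOf f φ) (hφ : IsSupercoercive φ) : IsSupercoercive f := by
  choose W hW e hWe using fun C : SymMat n => exists_eq_diagConj C
  have hnorm : ∀ C, ‖e C‖ = ‖C‖ := fun C => by
    conv_rhs => rw [hWe C, norm_diagConj (hW C)]
  have he : Tendsto e (Bornology.cobounded _) (Bornology.cobounded _) := by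
    rw [← tendsto_norm_atTop_iff_cobounded]
    simp only [hnorm]
    exact tendsto_norm_cobounded_atTop
  refine (Tendsto.comp hφ he).congr fun C => ?_
  have h1 := hf.apply_diagConj (hW C) (e C)
  rw [← hWe C] at h1
  simp only [Function.comp, hnorm, h1]

lemma add (hf : IsSpectralOf f φ) (hg : IsSpectralOf g₀ ψ) :
    IsSpectralOf (fun C => f C + g₀ C) (fun d => φ d + ψ d) :=
  fun C d hd σ => by beta_reduce; rw [hf C d hd σ, hg C d hd σ]

theorem bregmanProxAdmissible (hf : IsSpectralOf f φ) (hg : IsSpectralOf g₀ ψ)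
    (A : BregmanProxAdmissible φ ψ) : BregmanProxAdmissible f g₀ where
  gammaZero_left := hf.isGammaZero A.gammaZero_left
  legendre := hf.isLegendre A.gammaZero_left A.legendre
  gammaZero_right := hg.isGammaZero A.gammaZero_right
  domains := by
    obtain ⟨x, hx, hx'⟩ := A.domains
    exact ⟨diagConj 1 x, (hf.diagConj_mem_interior A.gammaZero_left (one_mem _)).2 hx,
      (hg.diagConj_mem_effDom (one_mem _)).2 hx'⟩
  growth := A.growth.imp hg.isBddBelow (hf.add hg).isSupercoercive

/-- The Bregman proximity operator of a spectral function. -/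
theorem isBregmanProx_diagConj (hf : IsSpectralOf f φ) (hg : IsSpectralOf g₀ ψ)
    (A : BregmanProxAdmissible φ ψ) (hU : U ∈ orthogonalGroup (Fin n) ℝ)
    {y p : EuclideanSpace ℝ (Fin n)} (hy : y ∈ interior (effDom φ))
    (hp : IsBregmanProx φ ψ y p) : IsBregmanProx f g₀ (diagConj U y) (diagConj U p) := by
  have A' := hf.bregmanProxAdmissible hg A
  have hφ := A.gammaZero_left
  have hψ := A.gammaZero_right
  have hY := (hf.diagConj_mem_interior hφ hU).2 hy
  have hgrad := (hf.hasGradientAt hφ A.legendre.smooth hU hy).gradient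
  refine isBregmanProx_of_isMinimizer A' hY fun Z => ?_
  by_cases hZ : g₀ Z + bregmanDiv f Z (diagConj U y) < ⊤
  · obtain ⟨hZf, hZg⟩ :=
      mem_effDom_of_add_bregmanDiv_lt_top A'.gammaZero_left A'.gammaZero_right hY hZ
    obtain ⟨h1, h2⟩ := hf.diagPart_le hφ hU hZf
    obtain ⟨h3, h4⟩ := hg.diagPart_le hψ hU hZg
    -- The vector problem is tested at the diagonal of the competitor `Z`.
    have hmin : ψ p + bregmanDiv φ p y ≤ _ := hp.2.1 (diagPart U Z)
    beta_reduce at hmin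
    rw [add_bregmanDiv_eq_coe hφ hψ hy (interior_subset hp.1.1) hp.1.2,
      add_bregmanDiv_eq_coe hφ hψ hy h1 h3, EReal.coe_le_coe_iff] at hmin
    rw [add_bregmanDiv_eq_coe A'.gammaZero_left A'.gammaZero_right hY hZf hZg,
      add_bregmanDiv_eq_coe A'.gammaZero_left A'.gammaZero_right hY
        ((hf.diagConj_mem_effDom hU).2 (interior_subset hp.1.1))
        ((hg.diagConj_mem_effDom hU).2 hp.1.2), EReal.coe_le_coe_iff, hgrad,
      inner_diagConj, inner_diagConj, map_sub, map_sub, diagPart_diagConj hU,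
      diagPart_diagConj hU, hf.finitePart_diagConj hU, hf.finitePart_diagConj hU,
      hg.finitePart_diagConj hU]
    linarith
  · rw [not_lt_top_iff.1 hZ]
    exact le_top

end IsSpectralOf

end SpectralFunctions

end

theorem corollary1 (n : ℕ) (φ ψ : EuclideanSpace ℝ (Fin n) → EReal) (f g₀ : SymMat n → EReal)
    (hf : IsSpectralOf f φ) (hg₀ : IsSpectralOf g₀ ψ)
    (hφ : IsGammaZero φ) (hφL : IsLegendre φ) (hψ : IsGammaZero ψ)
    (hdom : (interior (effDom φ) ∩ effDom ψ).Nonempty)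
    (hgrowth : IsBddBelow ψ ∨ IsSupercoercive (fun x => φ x + ψ x))
    (Y : SymMat n) (U : Matrix (Fin n) (Fin n) ℝ) (hU : U ∈ Matrix.orthogonalGroup (Fin n) ℝ)
    (y : EuclideanSpace ℝ (Fin n)) (hy : y ∈ interior (effDom φ))
    (hY : Y.toMat = U * Matrix.diagonal (fun i => y i) * Uᵀ) :
    BregmanProxDefinedAt φ ψ y ∧ BregmanProxDefinedAt f g₀ Y ∧
      (bregmanProx f g₀ Y).toMat =
        U * Matrix.diagonal (fun i => bregmanProx φ ψ y i) * Uᵀ := by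
  have A : BregmanProxAdmissible φ ψ := ⟨hφ, hφL, hψ, hdom, hgrowth⟩
  obtain rfl : Y = SymMat.diagConj U y := SymMat.toMat_injective hY
  have hd := A.definedAt hy
  have hprox := hf.isBregmanProx_diagConj hg₀ A hU hy hd.isBregmanProx
  refine ⟨hd, (hf.bregmanProxAdmissible hg₀ A).definedAt
    ((hf.diagConj_mem_interior hφ hU).2 hy), ?_⟩
  rw [hprox.bregmanProx_eq, SymMat.toMat_diagConj]
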